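/- For a vector $v\in\mathbb{R}^m$ and $T\subseteq[m]=\{1,\dots,m\}$, let $v_T\in\mathbb{R}^m$ be the vector that agrees with $v$ on $T$ and is zero elsewhere, let $T^c=[m]\setminus T$, and let $|v|$ and $v^2$ be taken entrywise. A matrix $A\in\mathbb{R}^{m\times n}$ satisfies the 2-Absolute Range Property (2-ARP) of order $L\in\mathbb{R}$ for $\psi\in(0,1)$ if $$\big\|(|Ax|^2-|Ay|^2)_T\big\|_1\le\psi\,\big\|(|Ax|^2-|Ay|^2)_{T^c}\big\|_1\qquad\text{for all }x,y\in\mathbb{R}^n\text{ and all }T\subseteq[m]\text{ with }|T|\le L.$$ **Lemma.** There exist universal constants $c_0,c_1,C>0$, $s\in(0,1)$ and $\psi\in(0,1)$ such that the following holds. If $m>c_0n$ and $A\in\mathbb{R}^{m\times n}$ is a random matrix whose entries are i.i.d. standard Gaussians $N(0,1)$, then with probability at least $1-C\exp(-c_1m)$ the matrix $A$ satisfies 2-ARP of order $sm$ for $\psi$, that is, $$\big\|(|Ax|^2-|Ay|^2)_T\big\|_1\le\psi\,\big\|(|Ax|^2-|Ay|^2)_{T^c}\big\|_1\qquad\text{for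 all }x,y\in\mathbb{R}^n\text{ and all }T\subseteq[m]\text{ with }|T|\le sm.$$ Consequently, with these constants, 2-ARP holds with high probability for $m$ sufficiently large: for every $\eta>0$ there is an $m_0$ such that for all $m\ge m_0$ and all $n$ with $m>c_0n$, a random $m\times n$ matrix with i.i.d. $N(0,1)$ entries satisfies 2-ARP of order $sm$ for $\psi$ with probability at least $1-\eta$. -/

import Mathlib

open MeasureTheory ProbabilityTheory

universe u

noncomputable section

/-- The vector `|A x|^p - |A y|^p` of `ℝ^m`, with absolute value and power taken entrywise. -/
def absPowDiff {m n : ℕ} (p : ℕ) (A : Matrix (Fin m) (Fin n) ℝ) (x y : Fin n → ℝ) :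
    Fin m → ℝ :=
  fun i => |(A.mulVec x) i| ^ p - |(A.mulVec y) i| ^ p

/-- The vector `v_T`, which agrees with `v` on `T` and is zero elsewhere. -/
def restrictTo {m : ℕ} (T : Finset (Fin m)) (v : Fin m → ℝ) : Fin m → ℝ :=
  fun i => if i ∈ T then v i else 0

/-- The `ℓ₁` norm of a vector in `ℝ^m`. -/
def l1Norm {m : ℕ} (v : Fin m → ℝ) : ℝ := ∑ i, |v i|

/-- The `p`-Absolute Range Property of order `L` with constant `ψ` (used for `p ∈ {1, 2}` and
`ψ ∈ (0, 1)`; the order `L` is a real number). -/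
def AbsoluteRangeProperty {m n : ℕ} (p : ℕ) (A : Matrix (Fin m) (Fin n) ℝ) (L ψ : ℝ) : Prop :=
  ∀ (x y : Fin n → ℝ) (T : Finset (Fin m)), (T.card : ℝ) ≤ L →
    l1Norm (restrictTo T (absPowDiff p A x y)) ≤
      ψ * l1Norm (restrictTo Tᶜ (absPowDiff p A x y))

/-- The entries of the random matrix `A` are i.i.d. standard Gaussians `N(0, 1)`. -/
structure IsStdGaussianMatrix {Ω : Type*} [MeasurableSpace Ω] {m n : ℕ}
    (A : Ω → Matrix (Fin m) (Fin n) ℝ) (P : Measure Ω) : Prop where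
  hasLaw : ∀ i j, HasLaw (fun ω => A ω i j) (gaussianReal 0 1) P
  indep : iIndepFun (fun (ij : Fin m × Fin n) (ω : Ω) => A ω ij.1 ij.2) P

end

/-! Entrywise, |Ax|^2 - |Ay|^2 is the product of A(x - y) and A(x + y). The property therefore
compares sums of |⟨a_i, u⟩⟨a_i, v⟩| over T and Tᶜ, and by homogeneity u and v may be unit vectors.
Over T, AM-GM bounds the sum by the quadratic mass of u and v on T. Over Tᶜ, a fixed fraction of the
rows has both factors at least δ. `absoluteRangeProperty_two_of_bounds` combines the two.

Both inputs must hold uniformly on the sphere. For one unit vector, the entries of its image are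
i.i.d. N(0, 1), and Chernoff bounds control the excess of their squares over a level τ and the
number of small entries. Truncating at τ treats all T at once: a set of size tm adds at most τtm to
the excess, so no union bound over T is needed. A net whose cardinality is exponential in n carries
both bounds to the sphere; m > c₀n absorbs that cardinality. -/

/-! ### Nets of the unit sphere -/

section Nets

open Metric Module

variable {E : Type*} [NormedAddCommGroup E] [NormedSpace ℝ E]

/-- A `ρ`-separated set in the unit ball has at most `(1 + 2 / ρ) ^ d` elements. -/
theorem card_le_of_separated_unitBall [FiniteDimensional ℝ E] {ρ : ℝ} (hρ : 0 < ρ) (N : Finset E)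
    (hN : ∀ c ∈ N, ‖c‖ ≤ 1) (h : ∀ c ∈ N, ∀ d ∈ N, c ≠ d → ρ ≤ ‖c - d‖) :
    (N.card : ℝ) ≤ (1 + 2 / ρ) ^ finrank ℝ E := by
  borelize E
  let μ : Measure E := Measure.addHaar
  have hδ : 0 < ρ / 2 := by positivity
  have hR : 0 < 1 + ρ / 2 := by positivity
  -- Volume comparison: balls of radius ρ/2 about the points are disjoint and lie in the ball of
  -- radius 1 + ρ/2.
  have D : Set.Pairwise (N : Set E) (Function.onFun Disjoint fun c => ball (c : E) (ρ / 2)) := by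
    intro c hc d hd hcd
    apply ball_disjoint_ball
    rw [dist_eq_norm]
    linarith [h c hc d hd hcd]
  have hsub : (⋃ c ∈ N, ball (c : E) (ρ / 2)) ⊆ ball (0 : E) (1 + ρ / 2) := by
    refine Set.iUnion₂_subset fun x hx => ball_subset_ball' ?_
    rw [dist_zero_right]
    linarith [hN x hx]
  have I : (N.card : ENNReal) * ENNReal.ofReal ((ρ / 2) ^ finrank ℝ E) * μ (ball 0 1) ≤
      ENNReal.ofReal ((1 + ρ / 2) ^ finrank ℝ E) * μ (ball 0 1) :=
    calc
      _ = μ (⋃ c ∈ N, ball (c : E) (ρ / 2)) := by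
        rw [measure_biUnion_finset D fun c _ => measurableSet_ball]
        simp only [μ.addHaar_ball_of_pos _ hδ]
        simp only [Finset.sum_const, nsmul_eq_mul, mul_assoc]
      _ ≤ μ (ball (0 : E) (1 + ρ / 2)) := measure_mono hsub
      _ = _ := by simp only [μ.addHaar_ball_of_pos _ hR]
  have J := (ENNReal.mul_le_mul_iff_left (measure_ball_pos μ _ zero_lt_one).ne'
    measure_ball_lt_top.ne).1 I
  have K := ENNReal.toReal_le_of_le_ofReal (pow_nonneg hR.le _) J
  rw [ENNReal.toReal_mul, ENNReal.toReal_natCast, ENNReal.toReal_ofReal (by positivity)] at K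
  have e : 1 + 2 / ρ = (1 + ρ / 2) / (ρ / 2) := by field_simp; ring
  rw [e, div_pow, le_div_iff₀ (by positivity)]
  exact K

/-- The unit sphere has a `ρ`-net with at most `(1 + 2 / ρ) ^ d` elements. -/
theorem exists_sphere_net [FiniteDimensional ℝ E] {ρ : ℝ} (hρ : 0 < ρ) :
    ∃ N : Finset E, (∀ w ∈ N, ‖w‖ = 1) ∧ (∀ v : E, ‖v‖ = 1 → ∃ w ∈ N, ‖v - w‖ ≤ ρ) ∧
      (N.card : ℝ) ≤ (1 + 2 / ρ) ^ finrank ℝ E := by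
  classical
  -- A separated set of largest cardinality is a net, since an uncovered unit vector could be added
  -- to it.
  let Q : Finset E → Prop := fun N =>
    (∀ w ∈ N, ‖w‖ = 1) ∧ ∀ c ∈ N, ∀ d ∈ N, c ≠ d → ρ ≤ ‖c - d‖
  have hQ : ∀ N, Q N → (N.card : ℝ) ≤ (1 + 2 / ρ) ^ finrank ℝ E := fun N hN =>
    card_le_of_separated_unitBall hρ N (fun c hc => (hN.1 c hc).le) hN.2
  let S : Set ℕ := {k | ∃ N, Q N ∧ N.card = k}
  have hS : S.Nonempty := ⟨0, ∅, by simp [Q], rfl⟩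
  have hb : BddAbove S := by
    refine ⟨⌊(1 + 2 / ρ) ^ finrank ℝ E⌋₊, ?_⟩
    rintro k ⟨N, hN, rfl⟩
    exact Nat.le_floor (hQ N hN)
  obtain ⟨N, hN, hc⟩ := Nat.sSup_mem hS hb
  refine ⟨N, hN.1, fun v hv => ?_, hQ N hN⟩
  by_contra! hcon
  have hvN : v ∉ N := fun hv' => by
    have := hcon v hv'
    simp only [sub_self, norm_zero] at this
    linarith
  have hins : Q (insert v N) := by
    refine ⟨by simpa [hv] using hN.1, ?_⟩
    intro c hc d hd hcd
    rcases Finset.mem_insert.1 hc with rfl | hc' <;>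
      rcases Finset.mem_insert.1 hd with rfl | hd'
    · exact absurd rfl hcd
    · exact (hcon d hd').le
    · rw [norm_sub_rev]; exact (hcon c hc').le
    · exact hN.2 c hc' d hd' hcd
  have := le_csSup hb (show (insert v N).card ∈ S from ⟨_, hins, rfl⟩)
  rw [Finset.card_insert_of_notMem hvN, ← hc] at this
  omega

/-- An operator bounded by `M` on a `1/2`-net of the unit sphere has norm at most `2 * M`. -/
theorem opNorm_le_of_net {F : Type*} [NormedAddCommGroup F] [NormedSpace ℝ F]
    (f : E →L[ℝ] F) {N : Finset E} {M : ℝ} (hM : 0 ≤ M)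
    (hN : ∀ v : E, ‖v‖ = 1 → ∃ w ∈ N, ‖v - w‖ ≤ 1 / 2) (hf : ∀ w ∈ N, ‖f w‖ ≤ M) :
    ‖f‖ ≤ 2 * M := by
  -- The norm is finite, so the term ‖f‖/2 from the net error can be absorbed on the left.
  have : ‖f‖ ≤ M + ‖f‖ * (1 / 2) := by
    refine f.opNorm_le_of_unit_norm (by positivity) fun v hv => ?_
    obtain ⟨w, hw, hvw⟩ := hN v hv
    calc ‖f v‖ = ‖f w + f (v - w)‖ := by rw [← map_add]; simp
      _ ≤ ‖f w‖ + ‖f (v - w)‖ := norm_add_le _ _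
      _ ≤ M + ‖f‖ * (1 / 2) := by
        gcongr
        · exact hf w hw
        · exact (f.le_opNorm _).trans (by gcongr)
  linarith

/-- If the sum of squares of finitely many linear forms is at most `M` on a `1/2`-net of the unit
sphere, then it is at most `4 * M * ‖v‖ ^ 2` everywhere. -/
theorem sum_sq_le_of_net [FiniteDimensional ℝ E] {ι : Type*} (T : Finset ι) (a : ι → E →ₗ[ℝ] ℝ)
    {N : Finset E} {M : ℝ}
    (hM : 0 ≤ M) (hN : ∀ v : E, ‖v‖ = 1 → ∃ w ∈ N, ‖v - w‖ ≤ 1 / 2)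
    (ha : ∀ w ∈ N, ∑ i ∈ T, (a i w) ^ 2 ≤ M) (v : E) :
    ∑ i ∈ T, (a i v) ^ 2 ≤ 4 * M * ‖v‖ ^ 2 := by
  let g : E →ₗ[ℝ] EuclideanSpace ℝ T :=
    (WithLp.linearEquiv 2 ℝ (T → ℝ)).symm.toLinearMap ∘ₗ LinearMap.pi fun i : T => a i
  have hg : ∀ v, ‖g v‖ ^ 2 = ∑ i ∈ T, (a i v) ^ 2 := fun v => by
    rw [EuclideanSpace.norm_sq_eq, ← Finset.sum_coe_sort T]
    simp [g]
  have h := opNorm_le_of_net g.toContinuousLinearMap (Real.sqrt_nonneg M) hN fun w hw => by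
    refine Real.le_sqrt_of_sq_le ?_
    simpa [hg] using ha w hw
  have h2 : ‖g v‖ ≤ 2 * √M * ‖v‖ :=
    (g.toContinuousLinearMap.le_opNorm v).trans (by gcongr)
  rw [← hg]
  calc ‖g v‖ ^ 2 ≤ (2 * √M * ‖v‖) ^ 2 := by gcongr
    _ = 4 * M * ‖v‖ ^ 2 := by rw [mul_pow, mul_pow, Real.sq_sqrt hM]; ring

end Nets

/-! ### Gaussian vectors and exponential moments -/

section Gaussian

/-- Applied to a unit vector, a standard Gaussian matrix gives i.i.d. standard Gaussians. -/
theorem IsStdGaussianMatrix.mulVec {Ω : Type*} [MeasurableSpace Ω] {P : Measure Ω} {m n : ℕ}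
    {A : Ω → Matrix (Fin m) (Fin n) ℝ} (hA : IsStdGaussianMatrix A P) {w : Fin n → ℝ}
    (hw : ∑ j, w j ^ 2 = 1) :
    (∀ i, HasLaw (fun ω => (A ω).mulVec w i) (gaussianReal 0 1) P) ∧
      iIndepFun (fun i ω => (A ω).mulVec w i) P := by
  classical
  have : IsProbabilityMeasure P := hA.indep.isProbabilityMeasure
  have hG : ∀ ij : Fin m × Fin n, HasGaussianLaw (fun ω => A ω ij.1 ij.2) P := fun ij =>
    (hA.hasLaw ij.1 ij.2).hasGaussianLaw
  have hL : ∀ ij : Fin m × Fin n, MemLp (fun ω => A ω ij.1 ij.2) 2 P := fun ij =>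
    (hG ij).memLp_two
  let L : (Fin m × Fin n → ℝ) →L[ℝ] (Fin m → ℝ) :=
    LinearMap.toContinuousLinearMap
      (LinearMap.pi fun i => ∑ j, w j • LinearMap.proj (R := ℝ) (φ := fun _ => ℝ) (i, j))
  -- Joint Gaussianity reduces independence of the entries to vanishing covariances.
  have hjoint : HasGaussianLaw (fun ω => ((A ω).mulVec w ·)) P := by
    have := (hA.indep.hasGaussianLaw hG).map_fun L
    convert! this using 1
    ext ω i
    simp [L, Matrix.mulVec, dotProduct, mul_comm]
  have hcov : ∀ i k, cov[fun ω => (A ω).mulVec w i, fun ω => (A ω).mulVec w k; P] =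
      if i = k then 1 else 0 := by
    intro i k
    have hcov' : ∀ j l, cov[fun ω => A ω i j * w j, fun ω => A ω k l * w l; P] =
        if i = k ∧ j = l then w j ^ 2 else 0 := by
      intro j l
      rw [covariance_mul_const_left, covariance_mul_const_right]
      split_ifs with h
      · obtain ⟨rfl, rfl⟩ := h
        rw [covariance_self (hG (i, j)).aemeasurable, (hA.hasLaw i j).variance_eq,
          variance_id_gaussianReal]
        simp [sq]
      · rw [(hA.indep.indepFun (i := (i, j)) (j := (k, l)) (by simpa using h)).covariance_eq_zero
          (hL (i, j)) (hL (k, l))]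
        simp
    simp only [Matrix.mulVec, dotProduct]
    rw [covariance_fun_sum_fun_sum (fun j => (hL (i, j)).mul_const _)
      (fun l => (hL (k, l)).mul_const _)]
    simp only [hcov']
    by_cases h : i = k <;> simp [h, hw]
  refine ⟨fun i => ?_, hjoint.iIndepFun_of_covariance_eq_zero fun i k hik => by simp [hcov, hik]⟩
  have hi : HasGaussianLaw (fun ω => (A ω).mulVec w i) P := hjoint.eval i
  refine ⟨hi.aemeasurable, ?_⟩
  rw [hi.map_eq_gaussianReal, ← covariance_self hi.aemeasurable, hcov]
  congr 1
  · simp only [Matrix.mulVec, dotProduct]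
    rw [integral_finsetSum _ fun j _ => ((hG (i, j)).integrable).mul_const _]
    refine Finset.sum_eq_zero fun j _ => ?_
    rw [integral_mul_const, (hA.hasLaw i j).integral_eq]
    simp
  · simp

/-- Chernoff bound for sums of a function of i.i.d. variables. -/
theorem measureReal_lt_sum_le_exp {Ω : Type*} [MeasurableSpace Ω] {P : Measure Ω} {m : ℕ}
    {X : Fin m → Ω → ℝ} {γ : Measure ℝ} (hX : ∀ i, HasLaw (X i) γ P)
    (hI : iIndepFun X P) {φ : ℝ → ℝ} (hφ : Measurable φ) {a b : ℝ}
    (hb : ∫⁻ x, ENNReal.ofReal (Real.exp (φ x)) ∂γ ≤ ENNReal.ofReal (Real.exp b)) :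
    P.real {ω | a * m < ∑ i, φ (X i ω)} ≤ Real.exp (-((a - b) * m)) := by
  have : IsProbabilityMeasure P := hI.isProbabilityMeasure
  -- For m = 0 no variable forces γ to be a probability measure.
  rcases Nat.eq_zero_or_pos m with rfl | hm
  · simp
  have : IsProbabilityMeasure γ := by
    rw [← (hX ⟨0, hm⟩).map_eq]
    exact Measure.isProbabilityMeasure_map (hX _).aemeasurable
  have hlaw := hI.hasLaw_pi hX
  have hset : MeasurableSet {x : Fin m → ℝ | a * m < ∑ i, φ (x i)} :=
    measurableSet_lt measurable_const (by fun_prop)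
  have h1 : P {ω | a * m < ∑ i, φ (X i ω)} =
      Measure.pi (fun _ => γ) {x : Fin m → ℝ | a * m < ∑ i, φ (x i)} := by
    rw [← hlaw.map_eq, Measure.map_apply_of_aemeasurable hlaw.aemeasurable hset]
    rfl
  have hind : iIndepFun (fun (i : Fin m) (x : Fin m → ℝ) => ENNReal.ofReal (Real.exp (φ (x i))))
      (Measure.pi fun _ => γ) :=
    iIndepFun_pi (X := fun _ x => ENNReal.ofReal (Real.exp (φ x))) (fun _ => by fun_prop)
  have h2 : ∫⁻ x : Fin m → ℝ, ENNReal.ofReal (Real.exp (∑ i, φ (x i))) ∂Measure.pi (fun _ => γ) ≤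
      ENNReal.ofReal (Real.exp (b * m)) := by
    simp_rw [Real.exp_sum, ENNReal.ofReal_prod_of_nonneg (fun _ _ => (Real.exp_pos _).le)]
    rw [lintegral_prod_eq_prod_lintegral_of_indepFun _ _ hind (fun i => by fun_prop)]
    calc ∏ i : Fin m, ∫⁻ x : Fin m → ℝ, ENNReal.ofReal (Real.exp (φ (x i))) ∂Measure.pi (fun _ => γ)
        ≤ ∏ _i : Fin m, ENNReal.ofReal (Real.exp b) := by
          refine Finset.prod_le_prod' fun i _ => ?_
          rw [(measurePreserving_eval (fun _ : Fin m => γ) i).lintegral_comp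
            (f := fun t => ENNReal.ofReal (Real.exp (φ t))) (by fun_prop)]
          exact hb
      _ = ENNReal.ofReal (Real.exp (b * m)) := by
          rw [Finset.prod_const, Finset.card_univ, Fintype.card_fin,
            ← ENNReal.ofReal_pow (Real.exp_pos _).le, ← Real.exp_nat_mul, mul_comm]
  have h3 := mul_meas_ge_le_lintegral (μ := Measure.pi (fun _ : Fin m => γ))
    (f := fun x => ENNReal.ofReal (Real.exp (∑ i, φ (x i)))) (by fun_prop)
    (ENNReal.ofReal (Real.exp (a * m)))
  have h4 : ENNReal.ofReal (Real.exp (a * m)) * P {ω | a * m < ∑ i, φ (X i ω)} ≤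
      ENNReal.ofReal (Real.exp (b * m)) := by
    refine le_trans ?_ (h3.trans h2)
    rw [h1]
    gcongr with x
    intro h
    exact ENNReal.ofReal_le_ofReal (Real.exp_le_exp.2 h.le)
  have h5 := ENNReal.toReal_le_of_le_ofReal (Real.exp_pos _).le h4
  rw [ENNReal.toReal_mul, ENNReal.toReal_ofReal (Real.exp_pos _).le] at h5
  rw [Measure.real, show -((a - b) * m) = b * m - a * m by ring, Real.exp_sub,
    le_div_iff₀ (Real.exp_pos _), mul_comm]
  exact h5

theorem gaussianPDFReal_zero_one_le_one (x : ℝ) : gaussianPDFReal 0 1 x ≤ 1 := by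
  rw [gaussianPDFReal]
  have h : 1 ≤ √(2 * Real.pi * ((1 : NNReal) : ℝ)) := by
    rw [Real.one_le_sqrt]
    have := Real.pi_gt_three
    simp only [NNReal.coe_one]
    linarith
  refine mul_le_one₀ (inv_le_one_of_one_le₀ h) (Real.exp_pos _).le (Real.exp_le_one_iff.2 ?_)
  rw [neg_div]
  exact neg_nonpos.2 (by positivity)

/-- The small-ball estimate for a standard Gaussian, as an exponential moment. -/
theorem lintegral_exp_indicator_gaussian_le {δ l : ℝ} (hδ : 0 ≤ δ) :
    ∫⁻ x, ENNReal.ofReal (Real.exp (if |x| < δ then l else 0)) ∂(gaussianReal 0 1) ≤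
      ENNReal.ofReal (Real.exp (2 * δ * Real.exp l)) := by
  have hs : MeasurableSet {x : ℝ | |x| < δ} := measurableSet_lt (by fun_prop) measurable_const
  have hball : gaussianReal 0 1 {x : ℝ | |x| < δ} ≤ ENNReal.ofReal (2 * δ) := by
    rw [gaussianReal_apply _ one_ne_zero]
    calc ∫⁻ x in {x : ℝ | |x| < δ}, gaussianPDF 0 1 x
        ≤ ∫⁻ _x in {x : ℝ | |x| < δ}, 1 := by
          refine lintegral_mono fun x => ?_
          rw [gaussianPDF]
          exact ENNReal.ofReal_le_one.2 (gaussianPDFReal_zero_one_le_one x)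
      _ = ENNReal.ofReal (2 * δ) := by
          have : {x : ℝ | |x| < δ} = Metric.ball 0 δ := by ext; simp
          rw [setLIntegral_one, this, Real.volume_ball]
  calc ∫⁻ x, ENNReal.ofReal (Real.exp (if |x| < δ then l else 0)) ∂(gaussianReal 0 1)
      ≤ ∫⁻ x, (1 + {x : ℝ | |x| < δ}.indicator (fun _ => ENNReal.ofReal (Real.exp l)) x)
          ∂(gaussianReal 0 1) := by
        refine lintegral_mono fun x => ?_
        by_cases h : |x| < δ <;> simp [h]
    _ = 1 + ENNReal.ofReal (Real.exp l) * gaussianReal 0 1 {x : ℝ | |x| < δ} := by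
        rw [lintegral_add_left measurable_const, lintegral_indicator_const hs]
        simp
    _ ≤ 1 + ENNReal.ofReal (Real.exp l) * ENNReal.ofReal (2 * δ) := by gcongr
    _ = ENNReal.ofReal (1 + Real.exp l * (2 * δ)) := by
        rw [ENNReal.ofReal_add zero_le_one (by positivity), ENNReal.ofReal_mul (Real.exp_pos _).le,
          ENNReal.ofReal_one]
    _ ≤ _ := by
        refine ENNReal.ofReal_le_ofReal ?_
        have := Real.add_one_le_exp (2 * δ * Real.exp l)
        linarith

theorem lintegral_exp_sq_div_four_gaussian_le :
    ∫⁻ x, ENNReal.ofReal (Real.exp (x ^ 2 / 4)) ∂(gaussianReal 0 1) ≤ ENNReal.ofReal 2 := by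
  rw [gaussianReal_of_var_ne_zero _ one_ne_zero,
    lintegral_withDensity_eq_lintegral_mul _ (measurable_gaussianPDF _ _) (by fun_prop)]
  have hint : Integrable (fun x : ℝ => (√(2 * Real.pi))⁻¹ * Real.exp (-(1 / 4) * x ^ 2)) :=
    (integrable_exp_neg_mul_sq (by norm_num : (0 : ℝ) < 1 / 4)).const_mul _
  have h : ∀ x : ℝ, (gaussianPDF 0 1 * fun x => ENNReal.ofReal (Real.exp (x ^ 2 / 4))) x =
      ENNReal.ofReal ((√(2 * Real.pi))⁻¹ * Real.exp (-(1 / 4) * x ^ 2)) := fun x => by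
    rw [Pi.mul_apply, gaussianPDF, ← ENNReal.ofReal_mul (gaussianPDFReal_nonneg _ _ _),
      gaussianPDFReal, mul_assoc, ← Real.exp_add]
    simp only [NNReal.coe_one, mul_one, sub_zero]
    congr 3
    ring
  simp_rw [h]
  rw [← ofReal_integral_eq_lintegral_ofReal hint (Filter.Eventually.of_forall fun x => by positivity)]
  refine ENNReal.ofReal_le_ofReal ?_
  rw [integral_const_mul, integral_gaussian, inv_mul_le_iff₀ (by positivity)]
  rw [Real.sqrt_le_left (by positivity), mul_pow, Real.sq_sqrt (by positivity)]
  nlinarith [Real.pi_pos]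

/-- Exponential moment of the part of the square of a standard Gaussian above the level `τ`. -/
theorem lintegral_exp_sq_sub_posPart_gaussian_le (τ : ℝ) :
    ∫⁻ x, ENNReal.ofReal (Real.exp (max (x ^ 2 - τ) 0 / 4)) ∂(gaussianReal 0 1) ≤
      ENNReal.ofReal (Real.exp (2 * Real.exp (-(τ / 4)))) := by
  -- The exponential of a maximum is at most the sum of the exponentials; the factor exp(-τ/4) makes
  -- the second term small.
  calc ∫⁻ x, ENNReal.ofReal (Real.exp (max (x ^ 2 - τ) 0 / 4)) ∂(gaussianReal 0 1)
      ≤ ∫⁻ x, (1 + ENNReal.ofReal (Real.exp (-(τ / 4))) * ENNReal.ofReal (Real.exp (x ^ 2 / 4)))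
          ∂(gaussianReal 0 1) := by
        refine lintegral_mono fun x => ?_
        rw [← ENNReal.ofReal_mul (Real.exp_pos _).le, ← Real.exp_add, ← ENNReal.ofReal_one,
          ← ENNReal.ofReal_add zero_le_one (Real.exp_pos _).le]
        refine ENNReal.ofReal_le_ofReal ?_
        rcases le_total (x ^ 2 - τ) 0 with h | h
        · simp [max_eq_right h, (Real.exp_pos _).le]
        · rw [max_eq_left h, show (x ^ 2 - τ) / 4 = -(τ / 4) + x ^ 2 / 4 by ring]
          linarith
    _ = 1 + ENNReal.ofReal (Real.exp (-(τ / 4))) *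
          ∫⁻ x, ENNReal.ofReal (Real.exp (x ^ 2 / 4)) ∂(gaussianReal 0 1) := by
        rw [lintegral_add_left measurable_const, lintegral_const_mul _ (by fun_prop)]
        simp
    _ ≤ 1 + ENNReal.ofReal (Real.exp (-(τ / 4))) * ENNReal.ofReal 2 := by
        gcongr
        exact lintegral_exp_sq_div_four_gaussian_le
    _ = ENNReal.ofReal (1 + Real.exp (-(τ / 4)) * 2) := by
        rw [ENNReal.ofReal_add zero_le_one (by positivity), ENNReal.ofReal_mul (Real.exp_pos _).le,
          ENNReal.ofReal_one]
    _ ≤ _ := by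
        refine ENNReal.ofReal_le_ofReal ?_
        have := Real.add_one_le_exp (2 * Real.exp (-(τ / 4)))
        linarith

end Gaussian

/-! ### Deterministic reduction -/

section Deterministic

open Finset

variable {m n : ℕ}

/-- The linear form on Euclidean space given by the `i`-th row of a matrix. -/
def rowForm (A : Matrix (Fin m) (Fin n) ℝ) (i : Fin m) : EuclideanSpace ℝ (Fin n) →ₗ[ℝ] ℝ :=
  LinearMap.proj i ∘ₗ A.mulVecLin ∘ₗ (WithLp.linearEquiv 2 ℝ (Fin n → ℝ)).toLinearMap

theorem rowForm_apply (A : Matrix (Fin m) (Fin n) ℝ) (i : Fin m) (v : EuclideanSpace ℝ (Fin n)) :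
    rowForm A i v = A.mulVec v.ofLp i := rfl

/-- Difference of squares: this bilinear form in x - y and x + y is what makes the exponent 2
tractable. -/
theorem absPowDiff_two_eq (A : Matrix (Fin m) (Fin n) ℝ) (x y : Fin n → ℝ) (i : Fin m) :
    absPowDiff 2 A x y i =
      rowForm A i (WithLp.toLp 2 (x - y)) * rowForm A i (WithLp.toLp 2 (x + y)) := by
  simp only [absPowDiff, rowForm_apply, Matrix.mulVec_sub, Matrix.mulVec_add, Pi.sub_apply,
    Pi.add_apply, sq_abs]
  ring

theorem l1Norm_restrictTo (T : Finset (Fin m)) (v : Fin m → ℝ) :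
    l1Norm (restrictTo T v) = ∑ i ∈ T, |v i| := by
  simp only [l1Norm, restrictTo, apply_ite abs, abs_zero]
  rw [Finset.sum_ite_mem, Finset.univ_inter]

/-- If the rows of `A` have small quadratic mass on all small sets and few rows are nearly
orthogonal to any given unit vector, then `A` has the 2-Absolute Range Property. -/
theorem absoluteRangeProperty_two_of_bounds (A : Matrix (Fin m) (Fin n) ℝ) {s δ κ : ℝ}
    (hs : s ≤ 1 / 8) (hκδ : κ ≤ 1 / 2 * (3 / 8 * δ ^ 2)) (hδ : 0 ≤ δ)
    (hT : ∀ T : Finset (Fin m), (T.card : ℝ) ≤ s * m → ∀ v, ‖v‖ = 1 →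
      ∑ i ∈ T, (rowForm A i v) ^ 2 ≤ κ * m)
    (hsmall : ∀ v, ‖v‖ = 1 → ((#{i | |rowForm A i v| < δ} : ℕ) : ℝ) ≤ m / 4) :
    AbsoluteRangeProperty 2 A (s * m) (1 / 2) := by
  have key : ∀ T : Finset (Fin m), (T.card : ℝ) ≤ s * m → ∀ u v, ‖u‖ = 1 → ‖v‖ = 1 →
      ∑ i ∈ T, |rowForm A i u * rowForm A i v| ≤
        1 / 2 * ∑ i ∈ Tᶜ, |rowForm A i u * rowForm A i v| := by
    intro T hTs u v hu hv
    have hm : (0 : ℝ) ≤ m := Nat.cast_nonneg m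
    have hup : ∑ i ∈ T, |rowForm A i u * rowForm A i v| ≤ κ * m := by
      have h2 : ∑ i ∈ T, |rowForm A i u * rowForm A i v| ≤
          ∑ i ∈ T, ((rowForm A i u) ^ 2 / 2 + (rowForm A i v) ^ 2 / 2) := by
        refine Finset.sum_le_sum fun i _ => ?_
        rw [abs_mul, ← sq_abs (rowForm A i u), ← sq_abs (rowForm A i v)]
        nlinarith [sq_nonneg (|rowForm A i u| - |rowForm A i v|)]
      rw [Finset.sum_add_distrib, ← Finset.sum_div, ← Finset.sum_div] at h2
      linarith [hT T hTs u hu, hT T hTs v hv]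
    -- Discarding at most m/8 rows for T and m/4 for each of u and v leaves 3m/8 rows.
    let G : Finset (Fin m) := Tᶜ \ (({i | |rowForm A i u| < δ} : Finset (Fin m)) ∪
      ({i | |rowForm A i v| < δ} : Finset (Fin m)))
    have hG : 3 / 8 * (m : ℝ) ≤ #G := by
      have h1 : #(Tᶜ) ≤ #G + (#{i | |rowForm A i u| < δ} + #{i | |rowForm A i v| < δ}) :=
        (Finset.card_le_card_sdiff_add_card).trans
          (Nat.add_le_add_left (Finset.card_union_le _ _) _)
      have h2 : #T + #(Tᶜ) = m := by rw [Finset.card_add_card_compl, Fintype.card_fin]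
      have h3 : (#T : ℝ) + #(Tᶜ) = m := by exact_mod_cast h2
      have h1' : (#(Tᶜ) : ℝ) ≤ #G +
          ((#{i | |rowForm A i u| < δ} : ℕ) + (#{i | |rowForm A i v| < δ} : ℕ)) := by
        exact_mod_cast h1
      have h4 := hsmall u hu
      have h5 := hsmall v hv
      have h6 : s * m ≤ 1 / 8 * m := by gcongr
      linarith
    have hlow : 3 / 8 * (m : ℝ) * δ ^ 2 ≤ ∑ i ∈ Tᶜ, |rowForm A i u * rowForm A i v| :=
      calc 3 / 8 * (m : ℝ) * δ ^ 2 ≤ #G * δ ^ 2 := by gcongr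
        _ = ∑ _i ∈ G, δ ^ 2 := by simp
        _ ≤ ∑ i ∈ G, |rowForm A i u * rowForm A i v| := by
          refine Finset.sum_le_sum fun i hi => ?_
          simp only [G, mem_sdiff, mem_union, mem_filter, mem_univ, true_and, not_or, not_lt] at hi
          rw [abs_mul, sq]
          exact mul_le_mul hi.2.1 hi.2.2 hδ (abs_nonneg _)
        _ ≤ _ := Finset.sum_le_sum_of_subset_of_nonneg Finset.sdiff_subset
          fun _ _ _ => abs_nonneg _
    have : κ * m ≤ 1 / 2 * (3 / 8 * δ ^ 2) * m := by gcongr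
    linarith
  intro x y T hTs
  rw [l1Norm_restrictTo, l1Norm_restrictTo]
  simp only [absPowDiff_two_eq]
  generalize WithLp.toLp 2 (x - y) = u
  generalize WithLp.toLp 2 (x + y) = v
  rcases eq_or_ne u 0 with rfl | hu
  · simp
  rcases eq_or_ne v 0 with rfl | hv
  · simp
  have hscale : ∀ i, |rowForm A i u * rowForm A i v| =
      ‖u‖ * ‖v‖ * |rowForm A i (‖u‖⁻¹ • u) * rowForm A i (‖v‖⁻¹ • v)| := by
    intro i
    have h1 := norm_pos_iff.2 hu
    have h2 := norm_pos_iff.2 hv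
    simp only [map_smul, smul_eq_mul, abs_mul, abs_inv, abs_norm]
    field_simp
  simp only [hscale, ← Finset.mul_sum]
  have h := key T hTs (‖u‖⁻¹ • u) (‖v‖⁻¹ • v)
    (by simp [norm_smul, hu]) (by simp [norm_smul, hv])
  have h' := mul_le_mul_of_nonneg_left h (by positivity : 0 ≤ ‖u‖ * ‖v‖)
  linarith

/-- The 2-Absolute Range Property follows from tail and small-ball bounds on a net. -/
theorem absoluteRangeProperty_two_of_net (A : Matrix (Fin m) (Fin n) ℝ)
    {N : Finset (EuclideanSpace ℝ (Fin n))} {s δ ε τ ρ : ℝ}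
    (hδ : 0 < δ) (hε : 0 ≤ ε) (hεδ : ε ≤ δ ^ 2 / 64) (hτ : 0 ≤ τ) (hs0 : 0 ≤ s) (hs : s ≤ 1 / 8)
    (hτs : τ * s ≤ ε) (hρ : ρ ≤ 1 / 2) (hρδ : ρ ^ 2 * (4 * (ε + τ)) ≤ δ ^ 2 / 8)
    (hN : ∀ v : EuclideanSpace ℝ (Fin n), ‖v‖ = 1 → ∃ w ∈ N, ‖v - w‖ ≤ ρ)
    (htail : ∀ w ∈ N, ∑ i, max ((rowForm A i w) ^ 2 - τ) 0 ≤ ε * m)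
    (hsmall : ∀ w ∈ N, ((#{i | |rowForm A i w| < 2 * δ} : ℕ) : ℝ) ≤ m / 8) :
    AbsoluteRangeProperty 2 A (s * m) (1 / 2) := by
  have hm : (0 : ℝ) ≤ m := Nat.cast_nonneg m
  have hsum : ∀ (t : ℝ), 0 ≤ t → ∀ T : Finset (Fin m), (T.card : ℝ) ≤ t * m → ∀ v,
      ∑ i ∈ T, (rowForm A i v) ^ 2 ≤ 4 * ((ε + τ * t) * m) * ‖v‖ ^ 2 := by
    intro t ht T hT v
    refine sum_sq_le_of_net T (rowForm A) (by positivity)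
      (fun v hv => (hN v hv).imp fun w hw => ⟨hw.1, hw.2.trans hρ⟩) (fun w hw => ?_) v
    calc ∑ i ∈ T, (rowForm A i w) ^ 2
        ≤ ∑ i ∈ T, (max ((rowForm A i w) ^ 2 - τ) 0 + τ) := by
          refine Finset.sum_le_sum fun i _ => ?_
          linarith [le_max_left ((rowForm A i w) ^ 2 - τ) 0]
      _ = ∑ i ∈ T, max ((rowForm A i w) ^ 2 - τ) 0 + #T * τ := by
          rw [Finset.sum_add_distrib]; simp
      _ ≤ ε * m + t * m * τ := by
          gcongr
          exact (Finset.sum_le_sum_of_subset_of_nonneg (Finset.subset_univ T)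
            fun _ _ _ => le_max_right _ _).trans (htail w hw)
      _ = (ε + τ * t) * m := by ring
  -- κ = 8ε comes from 4(ε + τs) with τs ≤ ε.
  refine absoluteRangeProperty_two_of_bounds A (κ := 8 * ε) (δ := δ) hs
    (by linarith [sq_nonneg δ]) hδ.le (fun T hT v hv => ?_) (fun v hv => ?_)
  · have h := hsum s hs0 T hT v
    rw [hv] at h
    have : (ε + τ * s) * m ≤ 2 * ε * m := by gcongr; linarith
    linarith
  · obtain ⟨w, hw, hvw⟩ := hN v hv
    let B : Finset (Fin m) := {i | δ ≤ |rowForm A i (v - w)|}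
    have hB : (#B : ℝ) ≤ m / 8 := by
      have h1 : #B * δ ^ 2 ≤ ∑ i, (rowForm A i (v - w)) ^ 2 :=
        calc #B * δ ^ 2 = ∑ _i ∈ B, δ ^ 2 := by simp
          _ ≤ ∑ i ∈ B, (rowForm A i (v - w)) ^ 2 := by
            refine Finset.sum_le_sum fun i hi => ?_
            rw [← sq_abs (rowForm A i (v - w))]
            have := (Finset.mem_filter.1 hi).2
            gcongr
          _ ≤ _ := Finset.sum_le_sum_of_subset_of_nonneg (Finset.subset_univ _)
            fun _ _ _ => sq_nonneg _
      -- Taking t = 1 bounds all of A, so the net error v - w reaches δ on at most m/8 rows.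
      have h2 := hsum 1 zero_le_one Finset.univ (by simp) (v - w)
      have h3 : 4 * ((ε + τ * 1) * m) * ‖v - w‖ ^ 2 ≤ m / 8 * δ ^ 2 :=
        calc 4 * ((ε + τ * 1) * m) * ‖v - w‖ ^ 2 ≤ 4 * ((ε + τ * 1) * m) * ρ ^ 2 := by gcongr
          _ = ρ ^ 2 * (4 * (ε + τ)) * m := by ring
          _ ≤ δ ^ 2 / 8 * m := by gcongr
          _ = m / 8 * δ ^ 2 := by ring
      exact le_of_mul_le_mul_right (h1.trans (h2.trans h3)) (by positivity)
    have hsub : ({i | |rowForm A i v| < δ} : Finset (Fin m)) ⊆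
        ({i | |rowForm A i w| < 2 * δ} : Finset (Fin m)) ∪ B := by
      intro i hi
      simp only [B, mem_union, mem_filter, mem_univ, true_and, map_sub] at hi ⊢
      by_contra! hcon
      have := abs_sub_abs_le_abs_sub (rowForm A i w) (rowForm A i v)
      rw [abs_sub_comm] at this
      linarith
    have h1 : ((#{i | |rowForm A i v| < δ} : ℕ) : ℝ) ≤
        (#{i | |rowForm A i w| < 2 * δ} : ℕ) + #B := by
      exact_mod_cast (Finset.card_le_card hsub).trans (Finset.card_union_le _ _)
    linarith [hsmall w hw]

end Deterministic

/-! ### Union bound over the net -/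

section Probabilistic

/-- The 2-Absolute Range Property holds for a Gaussian matrix outside an exponentially small set. -/
theorem IsStdGaussianMatrix.one_sub_le_measureReal_absoluteRangeProperty_two
    {Ω : Type*} [MeasurableSpace Ω] {P : Measure Ω} {m n : ℕ}
    {A : Ω → Matrix (Fin m) (Fin n) ℝ} (hA : IsStdGaussianMatrix A P) {s δ ε τ ρ : ℝ}
    (hδ : 0 < δ) (hδ' : 4 * δ * Real.exp 8 ≤ 1 / 2) (hε : 0 ≤ ε) (hε1 : ε ≤ 1)
    (hεδ : ε ≤ δ ^ 2 / 64)
    (hτ : 0 ≤ τ) (hτε : 2 * Real.exp (-(τ / 4)) ≤ ε / 8)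
    (hs0 : 0 ≤ s) (hs : s ≤ 1 / 8) (hτs : τ * s ≤ ε) (hρ0 : 0 < ρ) (hρ : ρ ≤ 1 / 2)
    (hρδ : ρ ^ 2 * (4 * (ε + τ)) ≤ δ ^ 2 / 8)
    (hmn : n * Real.log (1 + 2 / ρ) ≤ ε / 16 * m) :
    1 - 2 * Real.exp (-(ε / 16 * m)) ≤
      P.real {ω | AbsoluteRangeProperty 2 (A ω) (s * m) (1 / 2)} := by
  have : IsProbabilityMeasure P := hA.indep.isProbabilityMeasure
  obtain ⟨N, hN1, hN, hcard⟩ := exists_sphere_net (E := EuclideanSpace ℝ (Fin n)) hρ0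
  rw [finrank_euclideanSpace_fin] at hcard
  let φ : ℝ → ℝ := fun x => max (x ^ 2 - τ) 0 / 4
  -- With weight 8, a sum of at most m means at most m/8 small entries.
  let χ : ℝ → ℝ := fun x => if |x| < 2 * δ then 8 else 0
  have hφ : Measurable φ := by fun_prop
  have hχ : Measurable χ :=
    Measurable.ite (measurableSet_lt (by fun_prop) measurable_const) measurable_const
      measurable_const
  let bad₁ : EuclideanSpace ℝ (Fin n) → Set Ω := fun w =>
    {ω | ε / 4 * m < ∑ i, φ ((A ω).mulVec w i)}
  let bad₂ : EuclideanSpace ℝ (Fin n) → Set Ω := fun w =>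
    {ω | 1 * m < ∑ i, χ ((A ω).mulVec w i)}
  have hbad : ∀ w ∈ N, P.real (bad₁ w ∪ bad₂ w) ≤ 2 * Real.exp (-(ε / 8 * m)) := by
    intro w hw
    have hw1 : ∑ j, w.ofLp j ^ 2 = 1 := by
      have h := EuclideanSpace.norm_sq_eq w
      rw [hN1 w hw] at h
      simpa using h.symm
    obtain ⟨hlaw, hind⟩ := hA.mulVec hw1
    have h1 : P.real (bad₁ w) ≤ Real.exp (-((ε / 4 - ε / 8) * m)) :=
      measureReal_lt_sum_le_exp hlaw hind hφ
        ((lintegral_exp_sq_sub_posPart_gaussian_le τ).trans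
          (ENNReal.ofReal_le_ofReal (Real.exp_le_exp.2 hτε)))
    have h2 : P.real (bad₂ w) ≤ Real.exp (-((1 - 1 / 2) * m)) :=
      measureReal_lt_sum_le_exp hlaw hind hχ
        ((lintegral_exp_indicator_gaussian_le (by positivity)).trans
          (ENNReal.ofReal_le_ofReal (Real.exp_le_exp.2 (by linarith))))
    have h3 : Real.exp (-((1 - 1 / 2) * m)) ≤ Real.exp (-(ε / 8 * m)) := by
      gcongr
      linarith
    rw [show ε / 4 - ε / 8 = ε / 8 by ring] at h1
    linarith [measureReal_union_le (μ := P) (bad₁ w) (bad₂ w)]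
  have hunion : P.real (⋃ w ∈ N, (bad₁ w ∪ bad₂ w)) ≤ 2 * Real.exp (-(ε / 16 * m)) :=
    calc P.real (⋃ w ∈ N, (bad₁ w ∪ bad₂ w))
        ≤ ∑ w ∈ N, P.real (bad₁ w ∪ bad₂ w) := measureReal_biUnion_finset_le _ _
      _ ≤ ∑ _w ∈ N, 2 * Real.exp (-(ε / 8 * m)) := Finset.sum_le_sum hbad
      _ = N.card * (2 * Real.exp (-(ε / 8 * m))) := by simp
      -- The net's cardinality costs half of the exponential rate ε/8.
      _ ≤ Real.exp (ε / 16 * m) * (2 * Real.exp (-(ε / 8 * m))) := by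
        gcongr
        refine hcard.trans ?_
        rw [← Real.exp_log (show 0 < 1 + 2 / ρ by positivity), ← Real.exp_nat_mul]
        exact Real.exp_le_exp.2 hmn
      _ = 2 * Real.exp (-(ε / 16 * m)) := by
        rw [mul_left_comm, ← Real.exp_add]
        ring_nf
  have hsub : (⋃ w ∈ N, (bad₁ w ∪ bad₂ w))ᶜ ⊆
      {ω | AbsoluteRangeProperty 2 (A ω) (s * m) (1 / 2)} := by
    intro ω hω
    simp only [Set.mem_compl_iff, Set.mem_iUnion, Set.mem_union, not_exists, not_or, bad₁, bad₂,
      Set.mem_ofPred_eq, not_lt] at hω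
    refine absoluteRangeProperty_two_of_net (A ω) hδ hε hεδ hτ hs0 hs hτs hρ hρδ hN
      (fun w hw => ?_) (fun w hw => ?_)
    · have h := (hω w hw).1
      simp only [φ] at h
      rw [← Finset.sum_div] at h
      simp only [rowForm_apply]
      linarith
    · have h := (hω w hw).2
      simp only [χ] at h
      rw [← Finset.sum_filter, Finset.sum_const, nsmul_eq_mul, one_mul] at h
      rw [le_div_iff₀ (by norm_num)]
      convert! h
  have h1 : (1 : ℝ) ≤ P.real (⋃ w ∈ N, (bad₁ w ∪ bad₂ w)) +
      P.real (⋃ w ∈ N, (bad₁ w ∪ bad₂ w))ᶜ := by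
    have := measureReal_union_le (μ := P) (⋃ w ∈ N, (bad₁ w ∪ bad₂ w))
      (⋃ w ∈ N, (bad₁ w ∪ bad₂ w))ᶜ
    rwa [Set.union_compl_self, probReal_univ] at this
  linarith [measureReal_mono (μ := P) hsub]

end Probabilistic

/-! ### Choice of the constants -/

theorem lemma4p2 :
    ∃ c₀ c₁ C s ψ : ℝ, 0 < c₀ ∧ 0 < c₁ ∧ 0 < C ∧ (0 < s ∧ s < 1) ∧ (0 < ψ ∧ ψ < 1) ∧
      (∀ (m n : ℕ), c₀ * (n : ℝ) < (m : ℝ) →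
        ∀ (Ω : Type u) [MeasurableSpace Ω] (P : Measure Ω) [IsProbabilityMeasure P]
          (A : Ω → Matrix (Fin m) (Fin n) ℝ), IsStdGaussianMatrix A P →
          1 - C * Real.exp (-(c₁ * (m : ℝ))) ≤
            P.real {ω | AbsoluteRangeProperty 2 (A ω) (s * (m : ℝ)) ψ}) ∧
      (∀ η : ℝ, 0 < η → ∃ m₀ : ℕ, ∀ (m n : ℕ), m₀ ≤ m → c₀ * (n : ℝ) < (m : ℝ) →
        ∀ (Ω : Type u) [MeasurableSpace Ω] (P : Measure Ω) [IsProbabilityMeasure P]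
          (A : Ω → Matrix (Fin m) (Fin n) ℝ), IsStdGaussianMatrix A P →
          1 - η ≤ P.real {ω | AbsoluteRangeProperty 2 (A ω) (s * (m : ℝ)) ψ}) := by
  -- The order of choice matters: δ from the small-ball bound, then ε, then the level τ, then s and
  -- the mesh ρ, which fixes c₀.
  obtain ⟨δ, hδ, hδ', hδ1⟩ : ∃ δ : ℝ, 0 < δ ∧ 4 * δ * Real.exp 8 ≤ 1 / 2 ∧ δ ≤ 1 := by
    refine ⟨Real.exp (-8) / 8, by positivity, ?_, ?_⟩
    · rw [Real.exp_neg]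
      field_simp
      norm_num
    · have : Real.exp (-8) ≤ 1 := Real.exp_le_one_iff.2 (by norm_num)
      linarith
  obtain ⟨ε, hε, hε1, hεδ⟩ : ∃ ε : ℝ, 0 < ε ∧ ε ≤ 1 ∧ ε ≤ δ ^ 2 / 64 :=
    ⟨δ ^ 2 / 64, by positivity, by nlinarith, le_rfl⟩
  obtain ⟨τ, hτ, hτε⟩ : ∃ τ : ℝ, 0 < τ ∧ 2 * Real.exp (-(τ / 4)) ≤ ε / 8 := by
    refine ⟨-(4 * Real.log (ε / 16)), ?_, ?_⟩
    · have := Real.log_neg (show 0 < ε / 16 by positivity) (by linarith)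
      linarith
    · rw [show -(-(4 * Real.log (ε / 16)) / 4) = Real.log (ε / 16) by ring,
        Real.exp_log (by positivity)]
      linarith
  obtain ⟨s, hs0, hs, hτs⟩ : ∃ s : ℝ, 0 < s ∧ s ≤ 1 / 8 ∧ τ * s ≤ ε := by
    refine ⟨min (1 / 8) (ε / τ), by positivity, min_le_left _ _, ?_⟩
    calc τ * min (1 / 8) (ε / τ) ≤ τ * (ε / τ) := by gcongr; exact min_le_right _ _
      _ = ε := by field_simp
  obtain ⟨ρ, hρ0, hρ, hρδ⟩ :
      ∃ ρ : ℝ, 0 < ρ ∧ ρ ≤ 1 / 2 ∧ ρ ^ 2 * (4 * (ε + τ)) ≤ δ ^ 2 / 8 := by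
    let q := δ ^ 2 / 8 / (4 * (ε + τ))
    have hq : 0 < q := by positivity
    refine ⟨min (1 / 2) (√q), by positivity, min_le_left _ _, ?_⟩
    rw [← le_div_iff₀ (by positivity)]
    calc min (1 / 2) (√q) ^ 2 ≤ √q ^ 2 := by gcongr; exact min_le_right _ _
      _ = q := Real.sq_sqrt hq.le
  have hlog : 0 < Real.log (1 + 2 / ρ) := Real.log_pos (by linarith [div_pos two_pos hρ0])
  let c₀ := Real.log (1 + 2 / ρ) / (ε / 16)
  have hmain : ∀ (m n : ℕ), c₀ * (n : ℝ) < (m : ℝ) →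
        ∀ (Ω : Type u) [MeasurableSpace Ω] (P : Measure Ω) [IsProbabilityMeasure P]
          (A : Ω → Matrix (Fin m) (Fin n) ℝ), IsStdGaussianMatrix A P →
          1 - 2 * Real.exp (-(ε / 16 * (m : ℝ))) ≤
            P.real {ω | AbsoluteRangeProperty 2 (A ω) (s * (m : ℝ)) (1 / 2)} := by
    intro m n hmn Ω _ P _ A hA
    refine hA.one_sub_le_measureReal_absoluteRangeProperty_two hδ hδ' hε.le hε1 hεδ hτ.le hτε
      hs0.le hs hτs hρ0 hρ hρδ ?_
    rw [div_mul_eq_mul_div, div_lt_iff₀ (by positivity)] at hmn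
    linarith
  refine ⟨c₀, ε / 16, 2, s, 1 / 2, by positivity, by positivity, two_pos, ⟨hs0, by linarith⟩,
    by norm_num, hmain, fun η hη => ?_⟩
  have hlim : Filter.Tendsto (fun m : ℕ => 2 * Real.exp (-(ε / 16 * (m : ℝ)))) Filter.atTop
      (nhds 0) := by
    have h1 : Filter.Tendsto (fun m : ℕ => ε / 16 * (m : ℝ)) Filter.atTop Filter.atTop :=
      tendsto_natCast_atTop_atTop.const_mul_atTop (by positivity)
    simpa using (Real.tendsto_exp_neg_atTop_nhds_zero.comp h1).const_mul 2
  obtain ⟨m₀, hm₀⟩ := Filter.eventually_atTop.1 (hlim.eventually_le_const hη)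
  exact ⟨m₀, fun m n hm hmn Ω _ P _ A hA => by linarith [hmain m n hmn Ω P A hA, hm₀ m hm]⟩
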